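/- Let $D\subset\mathbb C^n$, $n>1$, be a domain with $C^2$-smooth boundary, let $\xi\in\partial D$, and let $\nu$ be the unit outward normal to $\partial D$ at $\xi$. Let $(\cdot,\cdot)$ be the canonical Hermitian product. Write $z=\xi-x_1\nu+\zeta$ with $x_1=-\operatorname{Re}(z-\xi,\nu)$ and $\zeta$ in the real hyperplane $T=\{v:\operatorname{Re}(v,\nu)=0\}$. In a neighbourhood $U=\{|x_1|<r,\ |\zeta|<r\}$ of $\xi$ let $D\cap U=\{z\in U: x_1>\psi(\zeta)\}$, where $\psi$ is a real $C^2$ function on $\{\zeta\in T:|\zeta|<r\}$ with $\psi(0)=0$ and $d\psi(0)=0$. For $\alpha>0$ let $$\mathcal A_\alpha(\xi)=\{z\in D:\ |(z-\xi,\nu)|<(1+\alpha)\delta_\xi(z),\ |z-\xi|^2<\alpha\,\delta_\xi(z)\},\qquad \delta_\xi(z)=\min\{\operatorname{dist}(z,\partial D),\,x_1\},$$ where $x_1$ is the distance from $z$ to the real tangent hyperplane at $\xi$, counted positively on the inner side. A function on $D$ is called admissibly bounded at $\xi$ if it is bounded on $\mathcal A_\alpha(\xi)$ for every $\alpha>0$;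 for a function defined only on $D\cap U$ this means that it is bounded on $\mathcal A_\alpha(\xi)\cap U$ for every $\alpha>0$. For $z\in D\cap U$ with $x_1>0$ put $d(z)=\min\{x_1,\,x_1-\psi(\zeta)\}$, and for $F$ holomorphic on $D$ put $$\nabla F(z)=\bigl(d(z)^2|\nabla_1F(z)|^2+d(z)\,|\nabla_{2,n}F(z)|^2\bigr)^{1/2},$$ where $|\nabla_1F(z)|$ is the modulus of the complex derivative of $F$ at $z$ in the direction $\nu$, and $|\nabla_{2,n}F(z)|^2$ is the sum of the squared moduli of the complex derivatives of $F$ at $z$ along an orthonormal basis of the complex tangent space $\{v:(v,\nu)=0\}$. Let $f$ be holomorphic on $D$ and suppose that the limit $L=\lim_{t\to0^+}f(\xi-t\nu)$ exists and is finite. If $(1+|f|^2)^{-1}\nabla f$ is admissibly bounded at $\xi$, then $f$ is admissibly bounded at $\xi$. -/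

import Mathlib

open Filter Topology

namespace AdmLim

noncomputable section

/-- The space `ℂⁿ` with its Euclidean norm and canonical Hermitian product. -/
abbrev Cn (n : ℕ) : Type := EuclideanSpace ℂ (Fin n)

variable {n : ℕ}

/-- The coordinate `x₁` of `z` with respect to the origin `ξ` and the unit outward normal `ν`:
the signed distance from `z` to the real tangent hyperplane at `ξ`, counted positively on the
side of the inner normal `-ν`. -/
def innerHeight (ξ ν z : Cn n) : ℝ := -(inner ℂ ν (z - ξ)).re

/-- The coordinate `ζ` of `z`: the real orthogonal projection of `z - ξ` to the real tangent
hyperplane `{v | Re ⟨ν, v⟩ = 0}`, so that `z = ξ - x₁ ν + ζ`. -/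
def tangentialPart (ξ ν z : Cn n) : Cn n := z - ξ + ((innerHeight ξ ν z : ℝ) : ℂ) • ν

/-- The coordinate neighbourhood `|x₁| < r`, `|ζ| < r` of `ξ`. -/
def coordBox (ξ ν : Cn n) (r : ℝ) : Set (Cn n) :=
  {z | |innerHeight ξ ν z| < r ∧ ‖tangentialPart ξ ν z‖ < r}

/-- In the coordinates `(x₁, ζ)` at `ξ` given by the unit vector `ν`, the set `D` is
`{x₁ > ψ(ζ)}` near `ξ`, where `ψ` is of class `C²`, `ψ(0) = 0`, and the derivative of `ψ` at `0`
along the hyperplane `{Re ⟨ν, v⟩ = 0}` is zero. In other words `∂D` is a `C²` hypersurface near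
`ξ`, and `ν` is the unit outward normal at `ξ`. Only the values of `ψ` on the
hyperplane matter. -/
structure IsC2GraphAt (D : Set (Cn n)) (ξ ν : Cn n) (r : ℝ) (ψ : Cn n → ℝ) : Prop where
  norm_normal : ‖ν‖ = 1
  r_pos : 0 < r
  contDiffOn : ContDiffOn ℝ 2 ψ (Metric.ball 0 r)
  map_zero : ψ 0 = 0
  fderiv_zero : ∀ v : Cn n, (inner ℂ ν v).re = 0 → fderiv ℝ ψ 0 v = 0
  mem_iff : ∀ z ∈ coordBox ξ ν r, z ∈ D ↔ ψ (tangentialPart ξ ν z) < innerHeight ξ ν z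

/-- `D` has `C²`-smooth boundary. -/
def HasC2Boundary (D : Set (Cn n)) : Prop :=
  ∀ ξ ∈ frontier D, ∃ (ν : Cn n) (r : ℝ) (ψ : Cn n → ℝ), IsC2GraphAt D ξ ν r ψ

/-- `δ_ξ(z)`: the minimum of the distances from `z` to `∂D` and, for `z` on the
inner side, to the real tangent hyperplane at `ξ`. -/
def deltaAt (D : Set (Cn n)) (ξ ν z : Cn n) : ℝ :=
  min (Metric.infDist z (frontier D)) (innerHeight ξ ν z)

/-- The admissible approach domain with vertex `ξ` and aperture `α`. -/
def approachDomain (D : Set (Cn n)) (ξ ν : Cn n) (α : ℝ) : Set (Cn n) :=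
  {z | z ∈ D ∧ ‖inner ℂ ν (z - ξ)‖ < (1 + α) * deltaAt D ξ ν z ∧
    ‖z - ξ‖ ^ 2 < α * deltaAt D ξ ν z}

/-- `g` is admissibly bounded at `ξ`: bounded on every admissible approach domain at `ξ`. -/
def AdmissiblyBounded {F : Type*} [Norm F] (D : Set (Cn n)) (ξ ν : Cn n) (g : Cn n → F) : Prop :=
  ∀ α : ℝ, 0 < α → ∃ M : ℝ, ∀ z ∈ approachDomain D ξ ν α, ‖g z‖ ≤ M

/-- The same for a function `g` that is considered only on a neighbourhood `U` of `ξ`. -/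
def AdmissiblyBoundedIn {F : Type*} [Norm F] (U D : Set (Cn n)) (ξ ν : Cn n) (g : Cn n → F) :
    Prop :=
  ∀ α : ℝ, 0 < α → ∃ M : ℝ, ∀ z ∈ approachDomain D ξ ν α ∩ U, ‖g z‖ ≤ M

/-- `d(z) = min {x₁, x₁ - ψ(ζ)}`. -/
def graphDist (ξ ν : Cn n) (ψ : Cn n → ℝ) (z : Cn n) : ℝ :=
  min (innerHeight ξ ν z) (innerHeight ξ ν z - ψ (tangentialPart ξ ν z))

/-- The complex tangent space: the Hermitian orthogonal complement of the complex normal line. -/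
abbrev complexTangent (ν : Cn n) : Submodule ℂ (Cn n) := (Submodule.span ℂ {ν})ᗮ

/-- `|∇₁ F|²`, the square of the modulus of the complex derivative in the normal direction. -/
def normalGradSq (ν : Cn n) (F : Cn n → ℂ) (z : Cn n) : ℝ := ‖fderiv ℂ F z ν‖ ^ 2

/-- `|∇_{2,n} F|²`, the sum of the squared moduli of the complex derivatives along an orthonormal
basis of the complex tangent space (it does not depend on the basis). -/
def tangentialGradSq (ν : Cn n) (F : Cn n → ℂ) (z : Cn n) : ℝ :=
  ∑ j, ‖fderiv ℂ F z (stdOrthonormalBasis ℂ (complexTangent ν) j : Cn n)‖ ^ 2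

/-- The weighted gradient `∇F(z) = (d(z)² |∇₁F(z)|² + d(z) |∇_{2,n}F(z)|²)^{1/2}`. -/
def weightedGrad (ξ ν : Cn n) (ψ : Cn n → ℝ) (F : Cn n → ℂ) (z : Cn n) : ℝ :=
  Real.sqrt (graphDist ξ ν ψ z ^ 2 * normalGradSq ν F z +
    graphDist ξ ν ψ z * tangentialGradSq ν F z)

end

end AdmLim

/-! Let z be an approach point near ξ with δ_ξ(z) = σ². A complex neighbourhood of a segment joins a
point of the inner normal at ξ to z, moving O(σ) overall but only O(σ²) in the complex normal
direction (`IsC2GraphAt.exists_line`). Its points keep height at least σ²/2 above both the graph and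
the tangent hyperplane, so they lie in one larger approach domain
(`IsC2GraphAt.exists_mem_approachDomain`). At this scale the weights in ∇f dominate the derivative
along the complex line (`norm_fderiv_le_weightedGrad`), so the restriction g of f has spherical
derivative |g'|/(1+|g|²) bounded uniformly in z. The finite limit of f on the normal bounds g(0).

A spherical bound alone would let g reach infinity in finite length; the absence of poles prevents
it. Where |g| > 2, it stays > 1 on a disc of fixed radius, log |g| is positive harmonic there, and
Harnack bounds it by three times its value at a neighbouring point. A chain of fixed length then
bounds g(1) = f(z) (`exists_bound_of_spherical_deriv_le`). Approach points away from ξ lie in a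
compact subset of D (`exists_bound_off_ball`). -/

namespace AdmLim

/-! ### One complex variable: Harnack chains and the spherical derivative -/

/-- A zero-free holomorphic function on a disc is an exponential there. -/
lemma exists_eq_exp_on_ball {g : ℂ → ℂ} {p : ℂ} {R : ℝ} (hR : 0 < R)
    (hg : DifferentiableOn ℂ g (Metric.ball p R)) (h0 : ∀ s ∈ Metric.ball p R, g s ≠ 0) :
    ∃ k : ℂ → ℂ, DifferentiableOn ℂ k (Metric.ball p R) ∧
      ∀ s ∈ Metric.ball p R, g s = Complex.exp (k s) := by
  have hpm : p ∈ Metric.ball p R := Metric.mem_ball_self hR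
  have hd : DifferentiableOn ℂ (fun s => deriv g s / g s) (Metric.ball p R) :=
    (hg.deriv Metric.isOpen_ball).div hg h0
  obtain ⟨k, hkp, hk⟩ := hd.isExactOn_ball.with_val_at p (Complex.log (g p))
  refine ⟨k, fun s hs => (hk s hs).differentiableAt.differentiableWithinAt, fun s hs => ?_⟩
  have hder : ∀ s ∈ Metric.ball p R, HasDerivAt (fun s => g s * Complex.exp (-k s)) 0 s := by
    intro s hs
    have h1 := (hg.differentiableAt (Metric.isOpen_ball.mem_nhds hs)).hasDerivAt
    have h2 := h1.mul ((hk s hs).neg.cexp)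
    refine h2.congr_deriv ?_
    have := h0 s hs
    simp only [Pi.neg_apply]
    field_simp
    ring
  have hc : g s * Complex.exp (-k s) = g p * Complex.exp (-k p) :=
    Metric.isOpen_ball.is_const_of_deriv_eq_zero (convex_ball p R).isPreconnected
      (fun s hs => (hder s hs).differentiableAt.differentiableWithinAt)
      (fun s hs => (hder s hs).deriv) hs hpm
  rw [hkp, Complex.exp_neg, Complex.exp_neg, Complex.exp_log (h0 p hpm),
    mul_inv_cancel₀ (h0 p hpm)] at hc
  have := Complex.exp_ne_zero (k s)
  field_simp at hc
  exact hc

/-- A Harnack inequality: if `|g| > 1` on a disc, then `log |g|` is a positive harmonic function,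
so at most triples between the centre and a point of the quarter disc. -/
lemma norm_le_pow_three_of_one_lt {g : ℂ → ℂ} {p q : ℂ} {R : ℝ} (hR : 0 < R)
    (hg : DifferentiableOn ℂ g (Metric.ball p R)) (h1 : ∀ s ∈ Metric.ball p R, 1 < ‖g s‖)
    (hq : ‖q - p‖ ≤ R / 4) : ‖g p‖ ≤ ‖g q‖ ^ 3 := by
  obtain ⟨k, hk, hgk⟩ := exists_eq_exp_on_ball hR hg
    (fun s hs h => by have := h1 s hs; rw [h, norm_zero] at this; linarith)
  have hre : ∀ s ∈ Metric.ball p R, 0 < (k s).re := by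
    intro s hs
    have := h1 s hs
    rwa [hgk s hs, Complex.norm_exp, Real.one_lt_exp_iff] at this
  have hpm : p ∈ Metric.ball p R := Metric.mem_ball_self hR
  have hqm : q ∈ Metric.ball p R := by rw [mem_ball_iff_norm]; linarith
  have hshift : ∀ z ∈ Metric.ball (0 : ℂ) R, p + z ∈ Metric.ball p R := by
    intro z hz
    rw [mem_ball_iff_norm, add_sub_cancel_left]
    simpa using hz
  have hM := hre p hpm
  -- The function z ↦ k(p) - k(p + z) vanishes at 0 and has real part below Re k(p). For |q - p| ≤
  -- R/4 the factor 2r/(R - r) is at most 2/3, so Re k(q) ≥ Re k(p)/3.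
  have hBC := Complex.borelCaratheodory_zero (f := fun z => k p - k (p + z)) (M := (k p).re)
    (R := R) (z := q - p) hM
    ((differentiableOn_const _).sub (hk.comp (by fun_prop) hshift))
    (fun z hz => by
      have := hre _ (hshift z hz)
      simp only [Set.mem_ofPred_eq, Complex.sub_re]
      linarith) hR (by rw [mem_ball_zero_iff]; linarith) (by simp)
  simp only [add_sub_cancel] at hBC
  have hb : 2 * (k p).re * ‖q - p‖ / (R - ‖q - p‖) ≤ 2 / 3 * (k p).re := by
    rw [div_le_iff₀ (by linarith)]
    nlinarith
  have hr := (Complex.re_le_norm _).trans (hBC.trans hb)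
  rw [Complex.sub_re] at hr
  rw [hgk p hpm, hgk q hqm, Complex.norm_exp, Complex.norm_exp, ← Real.exp_nat_mul]
  apply Real.exp_le_exp.2
  push_cast
  linarith

/-- A bound `M` for the spherical derivative makes `(1 + |g|²)⁻¹` Lipschitz with constant `M`. -/
lemma abs_inv_one_add_norm_sq_sub_le {g : ℂ → ℂ} {p q : ℂ} {R M : ℝ}
    (hg : DifferentiableOn ℂ g (Metric.ball p R))
    (hM : ∀ s ∈ Metric.ball p R, ‖deriv g s‖ ≤ M * (1 + ‖g s‖ ^ 2))
    (hq : q ∈ Metric.ball p R) :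
    |(1 + ‖g q‖ ^ 2)⁻¹ - (1 + ‖g p‖ ^ 2)⁻¹| ≤ M * ‖q - p‖ := by
  have hR : 0 < R := Metric.pos_of_mem_ball hq
  have hder : ∀ s ∈ Metric.ball p R, HasFDerivAt (fun s => (1 + ‖g s‖ ^ 2)⁻¹)
      (-((1 + ‖g s‖ ^ 2) ^ 2)⁻¹ • (2 • (innerSL ℝ (g s)).comp
        ((ContinuousLinearMap.toSpanSingleton ℂ (deriv g s)).restrictScalars ℝ))) s := by
    intro s hs
    have h1 := (hg.differentiableAt (Metric.isOpen_ball.mem_nhds hs)).hasDerivAt.hasFDerivAt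
    have h2 := (h1.restrictScalars ℝ).norm_sq.const_add 1
    have h3 := (hasDerivAt_inv (show (1 + ‖g s‖ ^ 2) ≠ 0 by positivity)).comp_hasFDerivAt s h2
    exact h3
  refine Convex.norm_image_sub_le_of_norm_hasFDerivWithin_le
    (fun s hs => (hder s hs).hasFDerivWithinAt) (fun s hs => ?_) (convex_ball p R)
    (Metric.mem_ball_self hR) hq
  have hMs := hM s hs
  have hM0 : 0 ≤ M := by
    by_contra h
    push Not at h
    nlinarith [norm_nonneg (deriv g s), sq_nonneg ‖g s‖]
  refine ContinuousLinearMap.opNorm_le_bound _ hM0 fun v => ?_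
  have h4 : |inner ℝ (g s) (v * deriv g s)| ≤ ‖g s‖ * (‖v‖ * ‖deriv g s‖) := by
    have := abs_real_inner_le_norm (g s) (v * deriv g s)
    rwa [norm_mul] at this
  have h5 : ‖(-((1 + ‖g s‖ ^ 2) ^ 2)⁻¹ • (2 • (innerSL ℝ (g s)).comp
        ((ContinuousLinearMap.toSpanSingleton ℂ (deriv g s)).restrictScalars ℝ))) v‖
      = ((1 + ‖g s‖ ^ 2) ^ 2)⁻¹ * (2 * |inner ℝ (g s) (v * deriv g s)|) := by
    simp only [smul_apply, ContinuousLinearMap.comp_apply,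
      ContinuousLinearMap.coe_restrictScalars', ContinuousLinearMap.toSpanSingleton_apply,
      innerSL_apply_apply, smul_eq_mul, Real.norm_eq_abs, abs_mul, abs_neg, nsmul_eq_mul]
    rw [abs_of_nonneg (by positivity : (0:ℝ) ≤ ((1 + ‖g s‖ ^ 2) ^ 2)⁻¹)]
    norm_num
  rw [h5, inv_mul_le_iff₀ (by positivity)]
  -- One factor 1 + |g|² cancels against the hypothesis, the other against 2|g| ≤ 1 + |g|².
  calc 2 * |inner ℝ (g s) (v * deriv g s)| ≤ 2 * (‖g s‖ * (‖v‖ * ‖deriv g s‖)) := by gcongr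
    _ ≤ 2 * (‖g s‖ * (‖v‖ * (M * (1 + ‖g s‖ ^ 2)))) := by gcongr
    _ = (2 * ‖g s‖) * ((1 + ‖g s‖ ^ 2) * (M * ‖v‖)) := by ring
    _ ≤ (1 + ‖g s‖ ^ 2) * ((1 + ‖g s‖ ^ 2) * (M * ‖v‖)) := by
        gcongr
        nlinarith [sq_nonneg (‖g s‖ - 1)]
    _ = _ := by ring

/-- One step of the chain: a bounded spherical derivative forces `|g|` to be large near every
point where it is large. -/
lemma max_two_norm_le_pow_three {g : ℂ → ℂ} {p q : ℂ} {R M : ℝ} (hR : 0 < R) (hMR : M * R ≤ 1 / 4)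
    (hM0 : 0 ≤ M)
    (hg : DifferentiableOn ℂ g (Metric.ball p R))
    (hM : ∀ s ∈ Metric.ball p R, ‖deriv g s‖ ≤ M * (1 + ‖g s‖ ^ 2))
    (hq : ‖q - p‖ ≤ R / 4) : max 2 ‖g p‖ ≤ max 2 ‖g q‖ ^ 3 := by
  have h2 : (2 : ℝ) ≤ max 2 ‖g q‖ ^ 3 :=
    calc (2 : ℝ) ≤ 2 ^ 3 := by norm_num
      _ ≤ _ := by gcongr; exact le_max_left _ _
  refine max_le h2 ?_
  by_cases hp : ‖g p‖ ≤ 2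
  · exact hp.trans h2
  push Not at hp
  refine (norm_le_pow_three_of_one_lt hR hg (fun s hs => ?_) hq).trans
    (by gcongr; exact le_max_right _ _)
  have h := abs_inv_one_add_norm_sq_sub_le hg hM hs
  have h3 : M * ‖s - p‖ ≤ 1 / 4 := by
    rw [mem_ball_iff_norm] at hs
    exact (mul_le_mul_of_nonneg_left hs.le hM0).trans hMR
  -- The threshold 2 works because 1/5 + 1/4 < 1/2, and (1 + |g|²)⁻¹ < 1/2 means |g| > 1.
  have h4 : (1 + ‖g p‖ ^ 2)⁻¹ ≤ 1 / 5 := by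
    rw [inv_le_comm₀ (by positivity) (by norm_num)]
    nlinarith
  have h5 : (1 + ‖g s‖ ^ 2)⁻¹ < 1 / 2 := by linarith [(abs_le.1 h).2]
  rw [inv_lt_comm₀ (by positivity) (by norm_num)] at h5
  by_contra hcon
  push Not at hcon
  nlinarith [norm_nonneg (g s)]

/-- If the spherical derivative of `g` is at most `M` on the `η`-neighbourhood of the segment
`[0, 1]`, then `|g 1|` is bounded in terms of `M`, `η` and a bound for `|g 0|`. -/
theorem exists_bound_of_spherical_deriv_le (M η B : ℝ) (hM0 : 0 ≤ M) (hη : 0 < η) :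
    ∃ B' : ℝ, ∀ g : ℂ → ℂ,
      (∀ a : ℝ, 0 ≤ a → a ≤ 1 → ∀ s ∈ Metric.ball (a : ℂ) η,
        DifferentiableAt ℂ g s ∧ ‖deriv g s‖ ≤ M * (1 + ‖g s‖ ^ 2)) →
      ‖g 0‖ ≤ B → ‖g 1‖ ≤ B' := by
  obtain ⟨R, hR, hRη, hMR⟩ : ∃ R : ℝ, 0 < R ∧ R ≤ η ∧ M * R ≤ 1 / 4 := by
    refine ⟨min η (1 / (4 * (M + 1))), lt_min hη (by positivity), min_le_left _ _, ?_⟩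
    calc M * min η (1 / (4 * (M + 1))) ≤ M * (1 / (4 * (M + 1))) := by
          gcongr; exact min_le_right _ _
      _ ≤ 1 / 4 := by
          rw [mul_one_div, div_le_div_iff₀ (by positivity) (by norm_num)]
          linarith
  obtain ⟨N, hN⟩ := exists_nat_ge (4 / R)
  have hN0 : (0 : ℝ) < N := lt_of_lt_of_le (by positivity) hN
  refine ⟨max 2 B ^ (3 ^ N), fun g hg h0 => ?_⟩
  have key : ∀ j : ℕ, j ≤ N → max 2 ‖g ((j / N : ℝ) : ℂ)‖ ≤ max 2 B ^ (3 ^ j) := by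
    intro j
    induction j with
    | zero =>
      intro _
      simpa only [Nat.cast_zero, zero_div, Complex.ofReal_zero, pow_zero, pow_one]
        using max_le_max_left 2 h0
    | succ j ih =>
      intro hj
      have hjN : ((j + 1 : ℕ) : ℝ) / N ≤ 1 := by
        rw [div_le_one hN0]; exact_mod_cast hj
      have hball : ∀ s ∈ Metric.ball ((((j + 1 : ℕ) : ℝ) / N : ℝ) : ℂ) R,
          DifferentiableAt ℂ g s ∧ ‖deriv g s‖ ≤ M * (1 + ‖g s‖ ^ 2) := fun s hs =>
        hg _ (by positivity) hjN s (Metric.ball_subset_ball hRη hs)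
      -- The disc is centred at the new point; the point already controlled is q, at distance 1/N ≤
      -- R/4.
      refine (max_two_norm_le_pow_three (q := ((j / N : ℝ) : ℂ)) hR hMR hM0
        (fun s hs => (hball s hs).1.differentiableWithinAt) (fun s hs => (hball s hs).2) ?_).trans ?_
      · rw [← Complex.ofReal_sub, Complex.norm_real, Real.norm_eq_abs]
        have : (j / N : ℝ) - ((j + 1 : ℕ) : ℝ) / N = -(1 / N) := by push_cast; ring
        rw [this, abs_neg, abs_of_pos (by positivity)]
        rw [div_le_iff₀ hR] at hN
        rw [div_le_iff₀ hN0]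
        linarith
      · rw [pow_succ 3 j, pow_mul]
        have := ih (by omega)
        gcongr
  have := key N le_rfl
  rw [div_self hN0.ne', Complex.ofReal_one] at this
  exact (le_max_right _ _).trans this

/-! ### Coordinates at the boundary point -/

variable {n : ℕ}

lemma abs_innerHeight_sub_le {ξ ν : Cn n} (hν : ‖ν‖ = 1) (z w : Cn n) :
    |innerHeight ξ ν z - innerHeight ξ ν w| ≤ ‖z - w‖ := by
  have : innerHeight ξ ν z - innerHeight ξ ν w = -(inner ℂ ν (z - w)).re := by
    have h : z - w = (z - ξ) - (w - ξ) := by abel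
    rw [h, inner_sub_right, Complex.sub_re]
    simp only [innerHeight]
    ring
  rw [this, abs_neg]
  refine (Complex.abs_re_le_norm _).trans ((norm_inner_le_norm _ _).trans ?_)
  rw [hν, one_mul]

lemma innerHeight_self (ξ ν : Cn n) : innerHeight ξ ν ξ = 0 := by simp [innerHeight]

lemma tangentialPart_self (ξ ν : Cn n) : tangentialPart ξ ν ξ = 0 := by
  simp [tangentialPart, innerHeight_self]

lemma abs_innerHeight_le {ξ ν : Cn n} (hν : ‖ν‖ = 1) (z : Cn n) :
    |innerHeight ξ ν z| ≤ ‖z - ξ‖ := by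
  simpa [innerHeight_self] using abs_innerHeight_sub_le (ξ := ξ) hν z ξ

lemma norm_tangentialPart_sub_le {ξ ν : Cn n} (hν : ‖ν‖ = 1) (z w : Cn n) :
    ‖tangentialPart ξ ν z - tangentialPart ξ ν w‖ ≤ 2 * ‖z - w‖ := by
  have h : tangentialPart ξ ν z - tangentialPart ξ ν w
      = (z - w) + ((innerHeight ξ ν z - innerHeight ξ ν w : ℝ) : ℂ) • ν := by
    simp only [tangentialPart, Complex.ofReal_sub, sub_smul]
    abel
  rw [h]
  refine (norm_add_le _ _).trans ?_
  rw [norm_smul, hν, mul_one, Complex.norm_real, Real.norm_eq_abs]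
  linarith [abs_innerHeight_sub_le (ξ := ξ) hν z w]

lemma norm_tangentialPart_le {ξ ν : Cn n} (hν : ‖ν‖ = 1) (z : Cn n) :
    ‖tangentialPart ξ ν z‖ ≤ 2 * ‖z - ξ‖ := by
  simpa [tangentialPart_self] using norm_tangentialPart_sub_le (ξ := ξ) hν z ξ

lemma inner_self_eq_one_of_norm {ν : Cn n} (hν : ‖ν‖ = 1) : inner ℂ ν ν = 1 := by
  simp [inner_self_eq_norm_sq_to_K, hν]

/-- The projection removes only the real part of the normal component, so ζ need not be complex
tangent. -/
lemma inner_tangentialPart {ξ ν : Cn n} (hν : ‖ν‖ = 1) (z : Cn n) :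
    inner ℂ ν (tangentialPart ξ ν z) = Complex.I * ((inner ℂ ν (z - ξ)).im : ℂ) := by
  rw [tangentialPart, inner_add_right, inner_smul_right, inner_self_eq_one_of_norm hν]
  apply Complex.ext <;> simp [innerHeight, inner_sub_right]

lemma inner_tangentialPart_re {ξ ν : Cn n} (hν : ‖ν‖ = 1) (z : Cn n) :
    (inner ℂ ν (tangentialPart ξ ν z)).re = 0 := by
  rw [inner_tangentialPart hν]; simp

section Line

/-! Coordinates of the points of a complex line `s ↦ ξ - τ ν + s (v + κ ν)`. -/

variable {ξ ν v : Cn n} {τ κ y : ℝ}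

lemma inner_line (hν : ‖ν‖ = 1) (hv : inner ℂ ν v = Complex.I * (y : ℂ)) (s : ℂ) :
    inner ℂ ν (ξ - (τ : ℂ) • ν + s • (v + (κ : ℂ) • ν) - ξ) =
      -τ + s * (Complex.I * y + κ) := by
  have : ξ - (τ : ℂ) • ν + s • (v + (κ : ℂ) • ν) - ξ =
    (-(τ : ℂ)) • ν + s • (v + (κ : ℂ) • ν) := by
    rw [neg_smul]; abel
  rw [this, inner_add_right, inner_smul_right, inner_smul_right, inner_add_right, inner_smul_right,
    hv, inner_self_eq_one_of_norm hν]
  ring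

lemma innerHeight_line (hν : ‖ν‖ = 1) (hv : inner ℂ ν v = Complex.I * (y : ℂ)) (s : ℂ) :
    innerHeight ξ ν (ξ - (τ : ℂ) • ν + s • (v + (κ : ℂ) • ν)) = τ - s.re * κ + s.im * y := by
  rw [innerHeight, inner_line hν hv]
  simp
  ring

/-- Only Im s contributes a multiple of ν; for real s the tangential part is s • v, whatever the
lift κ. -/
lemma tangentialPart_line (hν : ‖ν‖ = 1) (hv : inner ℂ ν v = Complex.I * (y : ℂ)) (s : ℂ) :
    tangentialPart ξ ν (ξ - (τ : ℂ) • ν + s • (v + (κ : ℂ) • ν)) =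
      s • v + ((s.im : ℂ) * (y + κ * Complex.I)) • ν := by
  have h : ((s.im : ℂ) * (y + κ * Complex.I)) =
      -(τ : ℂ) + s * κ + ((τ - s.re * κ + s.im * y : ℝ) : ℂ) := by
    apply Complex.ext <;> simp
    ring
  rw [tangentialPart, innerHeight_line hν hv, h]
  module

end Line

/-! ### The boundary graph and the approach domains -/

/-- `ψ` vanishes to second order at `0` on the tangent hyperplane, in the form of a Lipschitz
estimate. -/
lemma IsC2GraphAt.exists_lipschitz {D : Set (Cn n)} {ξ ν : Cn n} {r : ℝ} {ψ : Cn n → ℝ}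
    (h : IsC2GraphAt D ξ ν r ψ) :
    ∃ C ρ : ℝ, 0 ≤ C ∧ 0 < ρ ∧ ∀ (m : ℝ) (v w : Cn n), m < ρ → ‖v‖ ≤ m → ‖w‖ ≤ m →
      (inner ℂ ν v).re = 0 → (inner ℂ ν w).re = 0 → |ψ v - ψ w| ≤ C * m * ‖v - w‖ := by
  have h2 : ContDiffAt ℝ 2 ψ 0 := h.contDiffOn.contDiffAt (Metric.ball_mem_nhds 0 h.r_pos)
  have h1 : ContDiffAt ℝ 1 (fderiv ℝ ψ) 0 := h2.fderiv_right (by norm_num)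
  obtain ⟨C, t, ht, hC⟩ := h1.exists_lipschitzOnWith
  obtain ⟨ρ, hρ, hρt⟩ := Metric.mem_nhds_iff.1 (inter_mem ht (Metric.ball_mem_nhds 0 h.r_pos))
  refine ⟨C, ρ, C.coe_nonneg, hρ, fun m v w hm hv hw hvν hwν => ?_⟩
  have hsub : ∀ x ∈ Metric.closedBall (0 : Cn n) m, x ∈ Metric.ball (0 : Cn n) ρ := fun x hx =>
    Metric.closedBall_subset_ball hm hx
  -- The derivative is compared with its value at 0, not with zero: that value vanishes only along
  -- the hyperplane and is arbitrary along ν.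
  have key := (convex_closedBall (0 : Cn n) m).norm_image_sub_le_of_norm_hasFDerivWithin_le'
    (f := ψ) (f' := fderiv ℝ ψ) (φ := fderiv ℝ ψ 0) (C := C * m) (x := w) (y := v)
    (fun x hx => by
      have hx' := (hρt (hsub x hx)).2
      have : ContDiffAt ℝ 2 ψ x :=
        h.contDiffOn.contDiffAt (Metric.isOpen_ball.mem_nhds hx')
      exact (this.differentiableAt (by norm_num)).hasFDerivAt.hasFDerivWithinAt)
    (fun x hx => by
      have := hC.dist_le_mul x (hρt (hsub x hx)).1 0 (hρt (Metric.mem_ball_self hρ)).1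
      rw [dist_eq_norm, dist_zero_right] at this
      exact this.trans (mul_le_mul_of_nonneg_left (by simpa using hx) C.coe_nonneg))
    (by simpa using hw) (by simpa using hv)
  rwa [h.fderiv_zero (v - w) (by rw [inner_sub_right, Complex.sub_re, hvν, hwν, sub_zero]),
    sub_zero] at key

/-- Packs smallness conditions on σ into a single threshold. -/
lemma exists_pos_forall_lt {F : ℝ → ℝ} (hF : Continuous F) (h0 : F 0 = 0) {c : ℝ} (hc : 0 < c) :
    ∃ ε : ℝ, 0 < ε ∧ ∀ σ, 0 < σ → σ < ε → F σ < c := by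
  have h : ∀ᶠ σ in 𝓝 (0 : ℝ), F σ < c :=
    hF.continuousAt.eventually_lt_const (by rwa [h0])
  obtain ⟨ε, hε, h⟩ := Metric.eventually_nhds_iff.1 h
  refine ⟨ε, hε, fun σ h1 h2 => h ?_⟩
  rw [Real.dist_eq, sub_zero, abs_of_pos h1]
  exact h2

/-- Points that are close to `ξ` at the scale `σ²` in the normal and `σ` in the tangential
directions, and have height at least `σ² / 2` above both the boundary and the tangent hyperplane,
lie in a fixed admissible approach domain. -/
lemma IsC2GraphAt.exists_mem_approachDomain {D : Set (Cn n)} {ξ ν : Cn n} {r : ℝ} {ψ : Cn n → ℝ}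
    (h : IsC2GraphAt D ξ ν r ψ) (hD : IsOpen D) (hξ : ξ ∈ frontier D) {A : ℝ} (hA : 0 < A) :
    ∃ β ε : ℝ, 0 < β ∧ 0 < ε ∧ ∀ (σ : ℝ) (w : Cn n), 0 < σ → σ < ε →
      ‖w - ξ‖ ≤ A * σ → ‖inner ℂ ν (w - ξ)‖ ≤ A * σ ^ 2 →
      σ ^ 2 / 2 ≤ innerHeight ξ ν w →
      σ ^ 2 / 2 ≤ innerHeight ξ ν w - ψ (tangentialPart ξ ν w) →
      w ∈ approachDomain D ξ ν β ∩ coordBox ξ ν r := by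
  obtain ⟨C, ρ, hC, hρ, hlip⟩ := h.exists_lipschitz
  have hr := h.r_pos
  have hν := h.norm_normal
  obtain ⟨ε, hε, hsmall⟩ := exists_pos_forall_lt (F := fun σ => 2 * (A * σ + σ ^ 2))
    (by fun_prop) (by simp) (c := min (min ρ r) (1 / (C + 1)))
    (lt_min (lt_min hρ hr) (by positivity))
  -- Since δ will be at least σ²/8, this aperture absorbs the factor 8 in both defining
  -- inequalities.
  refine ⟨8 * A + 8 * A ^ 2 + 1, ε, by positivity, hε, fun σ w hσ hσε hw hwν hx hxψ => ?_⟩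
  have hs := hsmall σ hσ hσε
  simp only [lt_min_iff] at hs
  set m := 2 * (A * σ + σ ^ 2) with hm
  obtain ⟨⟨hmρ, hmr⟩, hmC⟩ := hs
  have hm0 : 0 < m := by positivity
  have hCm : C * m ≤ 1 := by
    rw [lt_div_iff₀ (by positivity)] at hmC
    nlinarith
  have hσ2 : 0 < σ ^ 2 := by positivity
  have hbox : ∀ p : Cn n, ‖p - ξ‖ ≤ m / 2 → p ∈ coordBox ξ ν r := fun p hp =>
    ⟨by linarith [abs_innerHeight_le (ξ := ξ) hν p],
      by linarith [norm_tangentialPart_le (ξ := ξ) hν p]⟩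
  have hwm : ‖w - ξ‖ ≤ m / 2 := by rw [hm]; linarith
  have hwbox := hbox w hwm
  have hwD : w ∈ D := (h.mem_iff w hwbox).2 (by linarith)
  -- From w to p the height changes by at most |p - w| and ψ by at most 2|p - w|, together less than
  -- 3σ²/8 < σ²/2, so a frontier point p this close would lie in D.
  have hdist : σ ^ 2 / 8 ≤ Metric.infDist w (frontier D) := by
    refine (Metric.le_infDist ⟨ξ, hξ⟩).2 fun p hp => ?_
    by_contra hcon
    push Not at hcon
    rw [dist_comm, dist_eq_norm] at hcon
    have hpm : ‖p - ξ‖ ≤ m / 2 := by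
      have : ‖p - ξ‖ ≤ ‖p - w‖ + ‖w - ξ‖ := norm_sub_le_norm_sub_add_norm_sub _ _ _
      rw [hm]; linarith
    have h1 := hlip m (tangentialPart ξ ν p) (tangentialPart ξ ν w) hmρ
      (by linarith [norm_tangentialPart_le (ξ := ξ) hν p])
      (by linarith [norm_tangentialPart_le (ξ := ξ) hν w])
      (inner_tangentialPart_re hν p) (inner_tangentialPart_re hν w)
    have h2 := norm_tangentialPart_sub_le (ξ := ξ) hν p w
    have h3 : C * m * ‖tangentialPart ξ ν p - tangentialPart ξ ν w‖ ≤ 1 * (2 * ‖p - w‖) := by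
      gcongr
    have h4 := abs_innerHeight_sub_le (ξ := ξ) hν p w
    have hpD : p ∈ D := (h.mem_iff p (hbox p hpm)).2 (by
      linarith [(abs_le.1 h4).1, (abs_le.1 (h1.trans h3)).2])
    rw [hD.frontier_eq] at hp
    exact hp.2 hpD
  have hδ : σ ^ 2 / 8 ≤ deltaAt D ξ ν w := le_min hdist (by linarith)
  refine ⟨⟨hwD, ?_, ?_⟩, hwbox⟩
  · have : (1 + (8 * A + 8 * A ^ 2 + 1)) * (σ ^ 2 / 8) ≤
      (1 + (8 * A + 8 * A ^ 2 + 1)) * deltaAt D ξ ν w := by gcongr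
    nlinarith [mul_pos hA hσ2]
  · have h1 : (8 * A + 8 * A ^ 2 + 1) * (σ ^ 2 / 8) ≤
      (8 * A + 8 * A ^ 2 + 1) * deltaAt D ξ ν w := by gcongr
    have h2 : ‖w - ξ‖ ^ 2 ≤ (A * σ) ^ 2 := by gcongr
    nlinarith [mul_pos hA hσ2]

/-- Near `ξ` the distance to the boundary is at most the height above the graph. -/
lemma IsC2GraphAt.deltaAt_le {D : Set (Cn n)} {ξ ν : Cn n} {r : ℝ} {ψ : Cn n → ℝ}
    (h : IsC2GraphAt D ξ ν r ψ) (hD : IsOpen D) {z : Cn n} (hz : z ∈ D)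
    (hbox : z ∈ coordBox ξ ν r) (hψ : |ψ (tangentialPart ξ ν z)| < r) :
    deltaAt D ξ ν z ≤ innerHeight ξ ν z - ψ (tangentialPart ξ ν z) := by
  have hν := h.norm_normal
  have hpos := (h.mem_iff z hbox).1 hz
  set s := innerHeight ξ ν z - ψ (tangentialPart ξ ν z) with hs
  -- q is the graph point reached from z along ν; the bound |ψ| < r keeps it in the coordinate box.
  set q : Cn n := z + (s : ℂ) • ν with hq
  have hx : innerHeight ξ ν q = ψ (tangentialPart ξ ν z) := by
    have : q - ξ = (z - ξ) + (s : ℂ) • ν := by rw [hq]; abel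
    rw [innerHeight, this, inner_add_right, inner_smul_right, inner_self_eq_one_of_norm hν]
    simp only [mul_one, Complex.add_re, Complex.ofReal_re, hs]
    simp only [innerHeight]
    ring
  have hζ : tangentialPart ξ ν q = tangentialPart ξ ν z := by
    have : (innerHeight ξ ν z : ℂ) = s + ψ (tangentialPart ξ ν z) := by rw [hs]; push_cast; ring
    rw [tangentialPart, hx, hq]
    conv_rhs => rw [tangentialPart, this]
    module
  have hqD : q ∉ D := by
    rw [h.mem_iff q ⟨by rwa [hx], by rw [hζ]; exact hbox.2⟩, hx, hζ]
    exact lt_irrefl _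
  obtain ⟨y, hy, hyF⟩ : ∃ y ∈ segment ℝ z q, y ∈ frontier D := by
    by_contra! hcon
    have hcl : ∀ y ∈ segment ℝ z q, y ∈ closure D → y ∈ D := fun y hy hyc => by
      by_contra hyD
      exact hcon y hy (hD.frontier_eq ▸ ⟨hyc, hyD⟩)
    obtain ⟨y, -, hyD, hyc⟩ := (convex_segment (𝕜 := ℝ) z q).isPreconnected D (closure D)ᶜ hD
      isClosed_closure.isOpen_compl (fun y hy => or_iff_not_imp_right.2 fun hyc =>
        hcl y hy (not_not.1 hyc)) ⟨z, left_mem_segment ℝ z q, hz⟩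
      ⟨q, right_mem_segment ℝ z q, fun hqc => hqD (hcl q (right_mem_segment ℝ z q) hqc)⟩
    exact hyc (subset_closure hyD)
  refine (min_le_left _ _).trans ((Metric.infDist_le_dist_of_mem hyF).trans ?_)
  have h1 : dist z q = s := by
    rw [dist_eq_norm, hq, sub_add_cancel_left, norm_neg, norm_smul, hν, mul_one, Complex.norm_real,
      Real.norm_eq_abs, abs_of_pos (by linarith)]
  have h2 := dist_add_dist_of_mem_segment hy
  linarith [dist_nonneg (x := y) (y := q)]

/-! ### The weighted gradient along a direction -/

/-- Cauchy–Schwarz inequality for the derivative along the complex tangent space. -/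
lemma norm_fderiv_sq_le_tangentialGradSq (ν : Cn n) (F : Cn n → ℂ) (z : Cn n)
    (u : complexTangent ν) :
    ‖fderiv ℂ F z (u : Cn n)‖ ^ 2 ≤ ‖u‖ ^ 2 * tangentialGradSq ν F z := by
  set b := stdOrthonormalBasis ℂ (complexTangent ν) with hb
  have h1 : fderiv ℂ F z (u : Cn n) = ∑ j, inner ℂ (b j) u * fderiv ℂ F z (b j : Cn n) := by
    conv_lhs => rw [← b.sum_repr' u]
    simp [map_sum]
  have h2 : ‖fderiv ℂ F z (u : Cn n)‖ ≤ ∑ j, ‖inner ℂ (b j) u‖ * ‖fderiv ℂ F z (b j : Cn n)‖ := by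
    rw [h1]
    refine (norm_sum_le _ _).trans (Finset.sum_le_sum fun j _ => (norm_mul _ _).le)
  calc ‖fderiv ℂ F z (u : Cn n)‖ ^ 2
      ≤ (∑ j, ‖inner ℂ (b j) u‖ * ‖fderiv ℂ F z (b j : Cn n)‖) ^ 2 := by gcongr
    _ ≤ (∑ j, ‖inner ℂ (b j) u‖ ^ 2) * ∑ j, ‖fderiv ℂ F z (b j : Cn n)‖ ^ 2 :=
        Finset.sum_mul_sq_le_sq_mul_sq _ _ _
    _ = ‖u‖ ^ 2 * tangentialGradSq ν F z := by
        rw [b.sum_sq_norm_inner_right, tangentialGradSq, hb]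

lemma tangentialGradSq_nonneg (ν : Cn n) (F : Cn n → ℂ) (z : Cn n) :
    0 ≤ tangentialGradSq ν F z := Finset.sum_nonneg fun _ _ => sq_nonneg _

/-- The weighted gradient controls derivatives in the directions of length `δ` along the normal
and `√δ` along the complex tangent space. -/
lemma norm_fderiv_le_weightedGrad {ξ ν : Cn n} (hν : ‖ν‖ = 1) (ψ : Cn n → ℝ) (F : Cn n → ℂ)
    {w u : Cn n} {σ A : ℝ} (hσ : 0 < σ) (hA : 0 ≤ A) (hd : σ ^ 2 / 2 ≤ graphDist ξ ν ψ w)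
    (hu : ‖u‖ ≤ A * σ) (huν : ‖inner ℂ ν u‖ ≤ A * σ ^ 2) :
    ‖fderiv ℂ F w u‖ ≤ 5 * A * weightedGrad ξ ν ψ F w := by
  set d := graphDist ξ ν ψ w with hdd
  set W := weightedGrad ξ ν ψ F w with hW
  have hσ2 : 0 < σ ^ 2 := by positivity
  have hd0 : 0 < d := by linarith
  have ht0 := tangentialGradSq_nonneg ν F w
  have hn0 : 0 ≤ normalGradSq ν F w := sq_nonneg _
  have hW0 : 0 ≤ W := Real.sqrt_nonneg _
  have hWsq : W ^ 2 = d ^ 2 * normalGradSq ν F w + d * tangentialGradSq ν F w :=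
    Real.sq_sqrt (by positivity)
  have hn : d * ‖fderiv ℂ F w ν‖ ≤ W := by
    refine abs_le_of_sq_le_sq' ?_ hW0 |>.2
    rw [hWsq, mul_pow, normalGradSq]
    linarith [mul_nonneg hd0.le ht0]
  have ht : d * tangentialGradSq ν F w ≤ W ^ 2 := by
    rw [hWsq]
    linarith [mul_nonneg (sq_nonneg d) hn0]
  set c : ℂ := inner ℂ ν u with hc
  have hmem : u - c • ν ∈ complexTangent ν := by
    rw [Submodule.mem_orthogonal_singleton_iff_inner_right, inner_sub_right, inner_smul_right,
      inner_self_eq_one_of_norm hν, mul_one, sub_self]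
  set u' : complexTangent ν := ⟨u - c • ν, hmem⟩ with hu'
  have hu'norm : ‖u'‖ ≤ 2 * (A * σ) := by
    have h1 : ‖u'‖ = ‖u - c • ν‖ := rfl
    have h2 : ‖c‖ ≤ ‖u‖ := by
      have := norm_inner_le_norm (𝕜 := ℂ) ν u
      rwa [hν, one_mul] at this
    rw [h1]
    refine (norm_sub_le _ _).trans ?_
    rw [norm_smul, hν, mul_one]
    linarith
  -- Here √8 is rounded up to 3; with 2A from the normal part this gives 5A.
  have htan : ‖fderiv ℂ F w (u' : Cn n)‖ ≤ 3 * A * W := by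
    refine abs_le_of_sq_le_sq' ?_ (by positivity) |>.2
    calc ‖fderiv ℂ F w (u' : Cn n)‖ ^ 2 ≤ ‖u'‖ ^ 2 * tangentialGradSq ν F w :=
          norm_fderiv_sq_le_tangentialGradSq ν F w u'
      _ ≤ (2 * (A * σ)) ^ 2 * tangentialGradSq ν F w := by gcongr
      _ = 8 * A ^ 2 * (σ ^ 2 / 2 * tangentialGradSq ν F w) := by ring
      _ ≤ 8 * A ^ 2 * (d * tangentialGradSq ν F w) := by gcongr
      _ ≤ 8 * A ^ 2 * W ^ 2 := by gcongr
      _ ≤ (3 * A * W) ^ 2 := by nlinarith [sq_nonneg (A * W)]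
  have hnor : ‖c‖ * ‖fderiv ℂ F w ν‖ ≤ 2 * A * W := by
    calc ‖c‖ * ‖fderiv ℂ F w ν‖ ≤ A * σ ^ 2 * ‖fderiv ℂ F w ν‖ := by gcongr
      _ = 2 * A * (σ ^ 2 / 2 * ‖fderiv ℂ F w ν‖) := by ring
      _ ≤ 2 * A * (d * ‖fderiv ℂ F w ν‖) := by gcongr
      _ ≤ 2 * A * W := by gcongr
  have hsplit : u = c • ν + (u' : Cn n) := by simp [hu']
  have : fderiv ℂ F w u = c * fderiv ℂ F w ν + fderiv ℂ F w (u' : Cn n) := by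
    conv_lhs => rw [hsplit]
    simp
  rw [this]
  refine (norm_add_le _ _).trans ?_
  rw [norm_mul]
  linarith

/-! ### Discs joining the normal to an approach point -/

set_option maxHeartbeats 1600000 in
/-- Points `z` of the approach domain near `ξ` are joined to the normal at `ξ` by complex discs
at the scale of `δ = deltaAt D ξ ν z = σ²`, along which the height stays comparable to `δ`. -/
lemma IsC2GraphAt.exists_line {D : Set (Cn n)} {ξ ν : Cn n} {r : ℝ} {ψ : Cn n → ℝ}
    (h : IsC2GraphAt D ξ ν r ψ) (hD : IsOpen D) {α : ℝ} (hα : 0 < α) :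
    ∃ A η ε : ℝ, 0 < A ∧ 0 < η ∧ 0 < ε ∧
      ∀ z ∈ approachDomain D ξ ν α, ∀ σ : ℝ, 0 < σ → σ < ε → deltaAt D ξ ν z = σ ^ 2 →
      ∃ τ : ℝ, 0 < τ ∧ τ ≤ A * σ ^ 2 ∧ ∃ u : Cn n, z = ξ - (τ : ℂ) • ν + u ∧
        ‖u‖ ≤ A * σ ∧ ‖inner ℂ ν u‖ ≤ A * σ ^ 2 ∧
        ∀ a : ℝ, 0 ≤ a → a ≤ 1 → ∀ s ∈ Metric.ball (a : ℂ) η, ∀ w : Cn n,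
          w = ξ - (τ : ℂ) • ν + s • u →
          ‖w - ξ‖ ≤ A * σ ∧ ‖inner ℂ ν (w - ξ)‖ ≤ A * σ ^ 2 ∧
          σ ^ 2 / 2 ≤ innerHeight ξ ν w ∧
          σ ^ 2 / 2 ≤ innerHeight ξ ν w - ψ (tangentialPart ξ ν w) := by
  obtain ⟨C, ρ, hC, hρ, hlip⟩ := h.exists_lipschitz
  have hr := h.r_pos
  have hν := h.norm_normal
  -- Qσ bounds every tangential part on the discs: ‖v‖ ≤ 2(α + 1)σ, |s| ≤ 2, and at most σ more from
  -- Im s.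
  set Q : ℝ := 4 * (α + 1) + 1 with hQ
  have hQ1 : 1 ≤ Q := by linarith
  set K : ℝ := C * Q ^ 2 with hK
  have hK0 : 0 ≤ K := by positivity
  set E : ℝ := 1 + α + K with hE
  have hE1 : 1 ≤ E := by linarith
  -- With this η, leaving the real segment costs at most σ²/2: ηκ from the lift, 2ηκ from ψ and η(1
  -- + α)σ² from y.
  set η : ℝ := 1 / (2 * (3 * K + 1 + α)) with hη
  have hη0 : 0 < η := by positivity
  have hη1 : η ≤ 1 := by
    rw [hη, div_le_one (by positivity)]; linarith
  have hηK : η * (3 * K + 1 + α) = 1 / 2 := by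
    rw [hη]; field_simp
  obtain ⟨ε, hε, hsmall⟩ := exists_pos_forall_lt (F := fun σ => E * σ + Q * σ + C * (Q * σ) ^ 2)
    (by fun_prop) (by simp) (c := min (min ρ r) 1)
    (lt_min (lt_min hρ hr) (by positivity))
  refine ⟨5 * Q + 3 * E, η, ε, by positivity, hη0, hε, fun z hz σ hσ hσε hδ => ?_⟩
  have hs := hsmall σ hσ hσε
  simp only [lt_min_iff] at hs
  obtain ⟨⟨hsρ, hsr⟩, hs1⟩ := hs
  have hEσ0 : 0 < E * σ := by positivity
  have hQσ0 : 0 < Q * σ := by positivity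
  have hCQ0 : 0 ≤ C * (Q * σ) ^ 2 := by positivity
  have hσ2 : 0 < σ ^ 2 := by positivity
  have hQσ2 : 0 < Q * σ ^ 2 := by positivity
  have hEσ2 : 0 < E * σ ^ 2 := by positivity
  have hσQ : σ ≤ Q * σ := le_mul_of_one_le_left hσ.le hQ1
  have hEσ : E * σ ^ 2 ≤ σ := by
    have : E * σ * σ ≤ 1 * σ := by gcongr; linarith
    linarith
  obtain ⟨hzD, hzν, hzn⟩ := hz
  rw [hδ] at hzν hzn
  set t := innerHeight ξ ν z with ht
  set v := tangentialPart ξ ν z with hv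
  set y : ℝ := (inner ℂ ν (z - ξ)).im with hy
  have hvν : inner ℂ ν v = Complex.I * (y : ℂ) := inner_tangentialPart hν z
  have hδt : σ ^ 2 ≤ t := hδ ▸ min_le_right _ _
  have ht' : t ≤ (1 + α) * σ ^ 2 := by
    have : |t| ≤ ‖inner ℂ ν (z - ξ)‖ := by
      rw [ht, innerHeight, abs_neg]; exact Complex.abs_re_le_norm _
    linarith [le_abs_self t]
  have hy' : |y| ≤ (1 + α) * σ ^ 2 := (Complex.abs_im_le_norm _).trans hzν.le
  have hzn' : ‖z - ξ‖ ≤ (α + 1) * σ := by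
    refine abs_le_of_sq_le_sq' ?_ (by positivity) |>.2
    have : α * σ ^ 2 ≤ (α + 1) ^ 2 * σ ^ 2 := by gcongr; nlinarith
    linarith
  have hvn2 : 2 * ‖v‖ + σ ≤ Q * σ := by
    have := norm_tangentialPart_le (ξ := ξ) hν z
    rw [hQ]; linarith
  have hvn : ‖v‖ ≤ Q * σ := by linarith [norm_nonneg v]
  have hz_box : z ∈ coordBox ξ ν r := by
    refine ⟨?_, by change ‖v‖ < r; linarith⟩
    change |t| < r
    rw [abs_of_nonneg (by linarith)]
    have : t ≤ E * σ ^ 2 := ht'.trans (by gcongr; linarith)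
    linarith
  have hvre : (inner ℂ ν v).re = 0 := inner_tangentialPart_re hν z
  have hψv : |ψ v| < r := by
    have := hlip (Q * σ) v 0 (by linarith) hvn (by simpa using hQσ0.le) hvre (by simp)
    rw [h.map_zero, sub_zero, sub_zero] at this
    have h2 : C * (Q * σ) * ‖v‖ ≤ C * (Q * σ) * (Q * σ) := by gcongr
    have h3 : C * (Q * σ) * (Q * σ) = C * (Q * σ) ^ 2 := by ring
    linarith
  have hψt : σ ^ 2 ≤ t - ψ v := hδ ▸ h.deltaAt_le hD hzD hz_box hψv
  -- The starting point is lifted by κ, so the height at real a is t + (1 - a)κ. This pays for the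
  -- change of ψ between a • v and v, at most C(Qσ) · (1 - a)Qσ = (1 - a)κ; an unlifted segment
  -- could leave D.
  set κ : ℝ := K * σ ^ 2 with hκ
  have hκ0 : 0 ≤ κ := by positivity
  have hyκ : |y| + κ ≤ E * σ ^ 2 := by rw [hE, hκ]; linarith
  have hyκn : ‖Complex.I * (y : ℂ) + κ‖ ≤ E * σ ^ 2 := by
    refine (norm_add_le _ _).trans ?_
    rw [norm_mul, Complex.norm_I, one_mul, Complex.norm_real, Complex.norm_real, Real.norm_eq_abs,
      Real.norm_eq_abs, abs_of_nonneg hκ0]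
    exact hyκ
  have hτE : t + κ ≤ E * σ ^ 2 := by rw [hE, hκ]; linarith
  have hun : ‖v + (κ : ℂ) • ν‖ ≤ 2 * (Q * σ) := by
    refine (norm_add_le _ _).trans ?_
    rw [norm_smul, hν, mul_one, Complex.norm_real, Real.norm_eq_abs, abs_of_nonneg hκ0]
    have := abs_nonneg y
    linarith
  refine ⟨t + κ, by linarith, by linarith, v + (κ : ℂ) • ν, ?_, by linarith, ?_, ?_⟩
  · have : z = ξ - (t : ℂ) • ν + v := by rw [hv, tangentialPart, ← ht]; abel
    conv_lhs => rw [this]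
    push_cast
    module
  · rw [inner_add_right, inner_smul_right, inner_self_eq_one_of_norm hν, hvν, mul_one]
    linarith
  · intro a ha0 ha1 s hs w hw
    have hsa : ‖s - a‖ < η := mem_ball_iff_norm.1 hs
    have hs2 : ‖s‖ ≤ 2 := by
      have h1 : ‖s‖ ≤ ‖s - a‖ + ‖(a : ℂ)‖ := norm_le_norm_sub_add _ _
      rw [Complex.norm_real, Real.norm_eq_abs, abs_of_nonneg ha0] at h1
      linarith
    have hsre : |s.re - a| ≤ η := by
      have := Complex.abs_re_le_norm (s - a)
      simp only [Complex.sub_re, Complex.ofReal_re] at this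
      linarith
    have hsim : |s.im| ≤ η := by
      have := Complex.abs_im_le_norm (s - a)
      simp only [Complex.sub_im, Complex.ofReal_im, sub_zero] at this
      linarith
    have hxw : innerHeight ξ ν w = (t + κ) - s.re * κ + s.im * y := by
      rw [hw]; exact innerHeight_line hν hvν s
    have hζw : tangentialPart ξ ν w = s • v + ((s.im : ℂ) * (y + κ * Complex.I)) • ν := by
      rw [hw]; exact tangentialPart_line hν hvν s
    have hsy : -(η * ((1 + α) * σ ^ 2)) ≤ s.im * y := by
      have : |s.im * y| ≤ η * ((1 + α) * σ ^ 2) := by rw [abs_mul]; gcongr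
      exact (abs_le.1 this).1
    have hsκ : s.re * κ ≤ (a + η) * κ := by
      gcongr; linarith [(abs_le.1 hsre).2]
    have hxlow : t + (1 - a) * κ - η * κ - η * ((1 + α) * σ ^ 2) ≤ innerHeight ξ ν w := by
      rw [hxw]; linarith
    have hηδ : 3 * (η * κ) + η * ((1 + α) * σ ^ 2) = σ ^ 2 / 2 := by
      calc _ = η * (3 * K + 1 + α) * σ ^ 2 := by rw [hκ]; ring
        _ = _ := by rw [hηK]; ring
    have haκ : 0 ≤ (1 - a) * κ := mul_nonneg (by linarith) hκ0
    have hηκ : 0 ≤ η * κ := by positivity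
    have hcoef : ‖(s.im : ℂ) * (y + κ * Complex.I)‖ ≤ η * σ := by
      rw [norm_mul, Complex.norm_real, Real.norm_eq_abs]
      have : ‖(y : ℂ) + κ * Complex.I‖ ≤ σ := by
        refine (norm_add_le _ _).trans ?_
        rw [norm_mul, Complex.norm_I, mul_one, Complex.norm_real, Complex.norm_real,
          Real.norm_eq_abs, Real.norm_eq_abs, abs_of_nonneg hκ0]
        linarith
      gcongr
    have hζwn : ‖tangentialPart ξ ν w‖ ≤ Q * σ := by
      rw [hζw]
      refine (norm_add_le _ _).trans ?_
      rw [norm_smul, norm_smul, hν, mul_one]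
      have h1 : ‖s‖ * ‖v‖ ≤ 2 * ‖v‖ := by gcongr
      have h2 : η * σ ≤ 1 * σ := by gcongr
      linarith
    have hdiff : ‖tangentialPart ξ ν w - v‖ ≤ ((1 - a) + 2 * η) * (Q * σ) := by
      have h0 : tangentialPart ξ ν w - v =
          (s - 1) • v + ((s.im : ℂ) * (y + κ * Complex.I)) • ν := by
        rw [hζw, sub_smul, one_smul]; abel
      have h1 : ‖s - 1‖ ≤ η + (1 - a) := by
        have h2 : s - 1 = (s - a) + ((a - 1 : ℝ) : ℂ) := by push_cast; ring
        rw [h2]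
        refine (norm_add_le _ _).trans ?_
        rw [Complex.norm_real, Real.norm_eq_abs, abs_of_nonpos (by linarith)]
        linarith
      rw [h0]
      refine (norm_add_le _ _).trans ?_
      rw [norm_smul, norm_smul, hν, mul_one]
      have h3 : ‖s - 1‖ * ‖v‖ ≤ (η + (1 - a)) * (Q * σ) :=
        mul_le_mul h1 hvn (norm_nonneg _) (by linarith)
      have h4 : η * σ ≤ η * (Q * σ) := by gcongr
      linarith
    have hψw : |ψ (tangentialPart ξ ν w) - ψ v| ≤ (1 - a) * κ + 2 * (η * κ) := by
      refine (hlip (Q * σ) _ _ (by linarith) hζwn hvn (inner_tangentialPart_re hν w) hvre).trans ?_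
      calc C * (Q * σ) * ‖tangentialPart ξ ν w - v‖
          ≤ C * (Q * σ) * (((1 - a) + 2 * η) * (Q * σ)) := by gcongr
        _ = _ := by rw [hκ, hK]; ring
    refine ⟨?_, ?_, by linarith, by linarith [(abs_le.1 hψw).2]⟩
    · have h0 : w - ξ = s • (v + (κ : ℂ) • ν) - ((t + κ : ℝ) : ℂ) • ν := by rw [hw]; abel
      rw [h0]
      refine (norm_sub_le _ _).trans ?_
      rw [norm_smul, norm_smul, hν, mul_one, Complex.norm_real, Real.norm_eq_abs,
        abs_of_nonneg (by linarith)]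
      have h1 : ‖s‖ * ‖v + (κ : ℂ) • ν‖ ≤ 2 * (2 * (Q * σ)) := by gcongr
      linarith
    · rw [hw, inner_line hν hvν]
      refine (norm_add_le _ _).trans ?_
      rw [norm_neg, norm_mul, Complex.norm_real, Real.norm_eq_abs, abs_of_nonneg (by linarith)]
      have h1 : ‖s‖ * ‖Complex.I * (y : ℂ) + κ‖ ≤ 2 * (E * σ ^ 2) := by gcongr
      linarith

/-! ### Points away from the vertex, and conclusion -/

/-- Away from the vertex the approach domain is relatively compact in `D`. -/
lemma exists_bound_off_ball {D : Set (Cn n)} (hD : IsOpen D) (ξ : Cn n) {ν : Cn n} (hν : ‖ν‖ = 1)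
    {f : Cn n → ℂ} (hf : ContinuousOn f D) {α ε : ℝ} (hα : 0 < α) (hε : 0 < ε) :
    ∃ M : ℝ, ∀ z ∈ approachDomain D ξ ν α, ε ≤ ‖z - ξ‖ → ‖f z‖ ≤ M := by
  -- Non-strict inequalities make S closed, and positive distance to the frontier puts it in D. The
  -- radius α comes from ‖z - ξ‖² < αδ ≤ α‖z - ξ‖.
  set S : Set (Cn n) := {z | z ∈ closure D ∧ ‖z - ξ‖ ≤ α ∧ ε ≤ ‖z - ξ‖ ∧
    ‖z - ξ‖ ^ 2 ≤ α * Metric.infDist z (frontier D)} with hS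
  have hcl : IsClosed S := by
    have h1 : IsClosed {z : Cn n | ‖z - ξ‖ ≤ α} := isClosed_le (by fun_prop) (by fun_prop)
    have h2 : IsClosed {z : Cn n | ε ≤ ‖z - ξ‖} := isClosed_le (by fun_prop) (by fun_prop)
    have h3 : IsClosed {z : Cn n | ‖z - ξ‖ ^ 2 ≤ α * Metric.infDist z (frontier D)} :=
      isClosed_le (by fun_prop) (continuous_const.mul (Metric.continuous_infDist_pt _))
    exact isClosed_closure.inter (h1.inter (h2.inter h3))
  have hcomp : IsCompact S := by
    refine (isCompact_closedBall ξ α).of_isClosed_subset hcl fun z hz => ?_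
    rw [mem_closedBall_iff_norm]
    exact hz.2.1
  have hSD : S ⊆ D := by
    intro z hz
    by_contra hzD
    have hzF : z ∈ frontier D := by
      rw [hD.frontier_eq]; exact ⟨hz.1, hzD⟩
    have h1 := hz.2.2.2
    rw [Metric.infDist_zero_of_mem hzF, mul_zero] at h1
    have h2 : ε ^ 2 ≤ ‖z - ξ‖ ^ 2 := pow_le_pow_left₀ hε.le hz.2.2.1 2
    have : 0 < ε ^ 2 := by positivity
    linarith
  obtain ⟨M, hM⟩ := hcomp.exists_bound_of_continuousOn (hf.mono hSD)
  refine ⟨M, fun z hz hzε => hM z ⟨subset_closure hz.1, ?_, hzε, ?_⟩⟩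
  · have h1 : α * deltaAt D ξ ν z ≤ α * ‖z - ξ‖ := by
      gcongr
      exact (min_le_right _ _).trans ((le_abs_self _).trans (abs_innerHeight_le hν z))
    have h2 := hz.2.2
    have h3 : 0 < ‖z - ξ‖ := hε.trans_le hzε
    nlinarith
  · exact hz.2.2.le.trans (by gcongr; exact min_le_left _ _)

end AdmLim

theorem proposition1 {n : ℕ} (hn : 1 < n) (D : Set (AdmLim.Cn n))
    (hDo : IsOpen D) (hDc : IsConnected D) (hDb : AdmLim.HasC2Boundary D)
    (ξ : AdmLim.Cn n) (hξ : ξ ∈ frontier D)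
    (ν : AdmLim.Cn n) (r : ℝ) (ψ : AdmLim.Cn n → ℝ) (hψ : AdmLim.IsC2GraphAt D ξ ν r ψ)
    (f : AdmLim.Cn n → ℂ) (hf : DifferentiableOn ℂ f D)
    (L : ℂ) (hL : Tendsto (fun t : ℝ => f (ξ - (t : ℂ) • ν)) (𝓝[>] 0) (𝓝 L))
    (hgrad : AdmLim.AdmissiblyBoundedIn (AdmLim.coordBox ξ ν r) D ξ ν
      (fun z => (1 + ‖f z‖ ^ 2)⁻¹ * AdmLim.weightedGrad ξ ν ψ f z)) :
    AdmLim.AdmissiblyBounded D ξ ν f := by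
  open AdmLim in
  intro α hα
  have hν := hψ.norm_normal
  obtain ⟨A, η, ε₁, hA, hη, hε₁, hline⟩ := hψ.exists_line hDo hα
  obtain ⟨β, ε₂, hβ, hε₂, happ⟩ := hψ.exists_mem_approachDomain hDo hξ hA
  obtain ⟨M, hM⟩ := hgrad β hβ
  obtain ⟨B, hB⟩ := exists_bound_of_spherical_deriv_le (5 * A * |M|) η (‖L‖ + 1)
    (by positivity) hη
  obtain ⟨τ₀, hτ₀, hlim⟩ : ∃ τ₀ : ℝ, 0 < τ₀ ∧ ∀ τ : ℝ, 0 < τ → τ < τ₀ →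
      ‖f (ξ - (τ : ℂ) • ν)‖ ≤ ‖L‖ + 1 := by
    have := hL.norm.eventually_le_const (lt_add_one ‖L‖)
    obtain ⟨τ₀, hτ₀, h⟩ := (nhdsGT_basis (0 : ℝ)).eventually_iff.1 this
    exact ⟨τ₀, hτ₀, fun τ h1 h2 => h ⟨h1, h2⟩⟩
  obtain ⟨ε₃, hε₃, hA3⟩ := exists_pos_forall_lt (F := fun σ => A * σ ^ 2)
    (by fun_prop) (by simp) hτ₀
  set ε := min (min ε₁ ε₂) ε₃ with hε
  have hε0 : 0 < ε := lt_min (lt_min hε₁ hε₂) hε₃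
  -- The radius is ε² because δ ≤ ‖z - ξ‖: inside it, σ = √δ < ε.
  obtain ⟨B', hB'⟩ := exists_bound_off_ball hDo ξ hν hf.continuousOn hα (pow_pos hε0 2)
  refine ⟨max B B', fun z hz => ?_⟩
  by_cases hzε : ε ^ 2 ≤ ‖z - ξ‖
  · exact (hB' z hz hzε).trans (le_max_right _ _)
  refine le_trans ?_ (le_max_left _ _)
  push Not at hzε
  have hδ0 : 0 < deltaAt D ξ ν z := by
    have := (sq_nonneg ‖z - ξ‖).trans_lt hz.2.2
    exact (mul_pos_iff_of_pos_left hα).1 this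
  have hδε : deltaAt D ξ ν z < ε ^ 2 :=
    ((min_le_right _ _).trans ((le_abs_self _).trans (abs_innerHeight_le hν z))).trans_lt hzε
  set σ := Real.sqrt (deltaAt D ξ ν z) with hσ
  have hσ0 : 0 < σ := Real.sqrt_pos.2 hδ0
  have hσsq : deltaAt D ξ ν z = σ ^ 2 := (Real.sq_sqrt hδ0.le).symm
  have hσε : σ < ε := (Real.sqrt_lt' hε0).2 hδε
  simp only [hε, lt_min_iff] at hσε
  obtain ⟨τ, hτ, hτA, u, hzu, hun, huν, hw⟩ := hline z hz σ hσ0 hσε.1.1 hσsq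
  have key := hB (fun s => f (ξ - (τ : ℂ) • ν + s • u)) (fun a ha0 ha1 s hs => ?_) ?_
  · simpa only [one_smul, ← hzu] using key
  · obtain ⟨h1, h2, h3, h4⟩ := hw a ha0 ha1 s hs _ rfl
    have hmem := happ σ _ hσ0 hσε.1.2 h1 h2 h3 h4
    set w := ξ - (τ : ℂ) • ν + s • u with hwdef
    have hfw : DifferentiableAt ℂ f w := hf.differentiableAt (hDo.mem_nhds hmem.1.1)
    have hl : HasDerivAt (fun s : ℂ => ξ - (τ : ℂ) • ν + s • u) u s := by
      simpa using ((hasDerivAt_id s).smul_const u).const_add (ξ - (τ : ℂ) • ν)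
    have hd : HasDerivAt (fun s : ℂ => f (ξ - (τ : ℂ) • ν + s • u)) (fderiv ℂ f w u) s :=
      hfw.hasFDerivAt.comp_hasDerivAt s hl
    refine ⟨hd.differentiableAt, ?_⟩
    rw [hd.deriv]
    have hW : weightedGrad ξ ν ψ f w ≤ |M| * (1 + ‖f w‖ ^ 2) := by
      have h5 := (le_abs_self _).trans ((hM w hmem).trans (le_abs_self M))
      rwa [inv_mul_le_iff₀ (by positivity), mul_comm] at h5
    calc ‖fderiv ℂ f w u‖ ≤ 5 * A * weightedGrad ξ ν ψ f w :=
          norm_fderiv_le_weightedGrad hν ψ f hσ0 hA.le (le_min h3 h4) hun huν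
      _ ≤ 5 * A * (|M| * (1 + ‖f w‖ ^ 2)) := by gcongr
      _ = _ := by ring
  · simpa only [zero_smul, add_zero] using hlim τ hτ (hτA.trans_lt (hA3 σ hσ0 hσε.2))
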